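/- Let $K$ be a real closed field with a non-archimedean absolute value $|\cdot|_K\colon K\to\mathbb{R}_{\ge 0}$ (possibly trivial) that is compatible with the order of $K$: $0\le a\le b$ implies $|a|_K\le |b|_K$. Let $X$ be a variety over $K$, that is, a reduced, irreducible, separated scheme of finite type over $K$; for $p\in X$ let $K(p)$ be the residue field of $p$. The Berkovich analytification $X^{\mathrm{an}}$ is the set of pairs $(p,|\cdot|)$ with $p\in X$ and $|\cdot|$ a non-archimedean absolute value on $K(p)$ extending $|\cdot|_K$. The real analytification $X_r^{\mathrm{an}}$ is the set of triples $(p,|\cdot|,<)$ with $(p,|\cdot|)\in X^{\mathrm{an}}$ and $<$ an ordering of the field $K(p)$ compatible with $|\cdot|$ (that is, $0\le a\le b$ implies $|a|\le|b|$). It carries the coarsest topology such that the support map $\operatorname{supp}\colon X_r^{\mathrm{an}}\to X$, $x=(p_x,|\cdot|_x,<_x)\mapsto p_x$, is continuous and, for every open $U\subset X$ and every regular function $f$ on $U$, the map $\operatorname{supp}^{-1}(U)\to\mathbb{R}$, $x\mapsto \operatorname{sgn}_x(f)\,|f|_x$, is continuous. Here $\operatorname{sgn}_x(f)$ and $|f|_x$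 are the sign and the absolute value of the image of $f$ in $K(p_x)$. Likewise, $X^{\mathrm{an}}$ carries the coarsest topology such that the map $x=(p_x,|\cdot|_x)\mapsto p_x$ to $X$ is continuous and every map $x\mapsto|f|_x$ is continuous on the preimage of the domain $U$ of $f$. Let $\varphi\colon X_r^{\mathrm{an}}\to X^{\mathrm{an}}$, $(p,|\cdot|,<)\mapsto(p,|\cdot|)$. For a commutative ring $A$, let $\operatorname{Sper}(A)$ be the real spectrum of $A$: the set of orderings of $A$, that is, of subsets $P\subset A$ with $P+P\subset P$, $P\cdot P\subset P$, $P\cup -P=A$ and $P\cap -P$ a prime ideal, with the topology generated by the sets $\{P : -f\notin P\}$, $f\in A$. **Proposition.** Let $x=(p_x,|\cdot|_x)\in X^{\mathrm{an}}$. Let $\Gamma_x=|K(p_x)^*|_x$ be the value group of $|\cdot|_x$ (a multiplicative subgroup of $\mathbb{R}_{>0}$), let $2\Gamma_x$ denote the subgroup of squares in $\Gamma_x$, and let $k(x)$ be the residue field of the valuation ring $\{a\in K(p_x): |a|_x\le 1\}$. Then the fiber $\varphi^{-1}(x)$, with the subspace topology from $X_r^{\mathrm{an}}$, is homeomorphic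 to $D\times\operatorname{Sper} k(x)$, where $D$ is a discrete topological space of cardinality $|\Gamma_x/2\Gamma_x|$. -/

import Mathlib

universe u

noncomputable section

namespace RealAn

open AlgebraicGeometry CategoryTheory

section RealSpectrum

/-- The real spectrum of a commutative ring: the set of its orderings. -/
def Sper (A : Type u) [CommRing A] : Type u :=
  {P : RingPreordering A // P.IsOrdering}

variable {A : Type u} [CommRing A]

/-- `f ≥ 0` with respect to the ordering `P`, that is, `f ∈ P`. -/
def Sper.Nonneg (P : Sper A) (f : A) : Prop := f ∈ P.1

/-- `f > 0` with respect to the ordering `P`, that is, `-f ∉ P`. -/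
def Sper.Pos (P : Sper A) (f : A) : Prop := -f ∉ P.1

open Classical in
/-- The sign of `f` with respect to `P`: it is `1` if `f > 0`, it is `-1` if `-f > 0`,
and it is `0` if `f` lies in the support of `P`. -/
def Sper.sgn (P : Sper A) (f : A) : ℝ :=
  if P.Pos f then 1 else if P.Pos (-f) then -1 else 0

/-- The Harrison topology. -/
instance (A : Type u) [CommRing A] : TopologicalSpace (Sper A) :=
  TopologicalSpace.generateFrom {s | ∃ f : A, s = {P : Sper A | P.Pos f}}

end RealSpectrum

section ValuedField

variable {L : Type u} [Field L]

/-- An ordering `P` of `L` is compatible with an absolute value on `L` if `0 ≤ a ≤ b` with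
respect to `P` implies `|a| ≤ |b|`. -/
def Sper.Compatible (P : Sper L) (w : AbsoluteValue L ℝ) : Prop :=
  ∀ a b : L, P.Nonneg a → P.Nonneg (b - a) → w a ≤ w b

/-- The valuation ring `{a | |a| ≤ 1}` of a non-archimedean absolute value. -/
def valuationRing (w : AbsoluteValue L ℝ) (hw : IsNonarchimedean w) : ValuationSubring L where
  carrier := {a | w a ≤ 1}
  mul_mem' {a b} ha hb := by
    simp only [Set.mem_ofPred_eq, map_mul] at *
    exact mul_le_one₀ ha (w.nonneg b) hb
  one_mem' := by simp
  add_mem' {a b} ha hb := (hw a b).trans (max_le ha hb)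
  zero_mem' := by simp
  neg_mem' {a} ha := by simpa using ha
  mem_or_inv_mem' a := by
    simp only [Set.mem_ofPred_eq, map_inv₀]
    rcases le_total (w a) 1 with h | h
    · exact Or.inl h
    · exact Or.inr (inv_le_one_of_one_le₀ h)

/-- The residue field of the valuation ring of a non-archimedean absolute value. -/
abbrev residueFieldOf (w : AbsoluteValue L ℝ) (hw : IsNonarchimedean w) : Type u :=
  IsLocalRing.ResidueField (valuationRing w hw)

/-- The value group `Γ = |Lˣ|`, a multiplicative group of (positive) real numbers. -/
def valueGroup (w : AbsoluteValue L ℝ) : Subgroup ℝˣ :=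
  (Units.map (w : L →* ℝ)).range

/-- The quotient `Γ / 2Γ`. Since `Γ` is written multiplicatively, `2Γ` is the group of squares
of elements of `Γ`. -/
abbrev valueGroupModTwo (w : AbsoluteValue L ℝ) : Type :=
  valueGroup w ⧸ (powMonoidHom 2 : valueGroup w →* valueGroup w).range

end ValuedField

section Analytification

variable {K : Type u} [Field K] {X : Scheme.{u}}

/-- The structure map `K → K(p)` into the residue field at a point `p` of a `K`-scheme. -/
def scalarMap (f : X ⟶ Spec (CommRingCat.of K)) (p : X) : K →+* X.residueField p :=
  (Spec.preimage (X.fromSpecResidueField p ≫ f)).hom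

/-- The points of the Berkovich analytification `X^an` of a `K`-scheme `X`: pairs of a scheme
point `p` and a non-archimedean absolute value on `K(p)` that extends the one on `K`. -/
structure Analytification (v : AbsoluteValue K ℝ) (f : X ⟶ Spec (CommRingCat.of K)) where
  pt : X
  absVal : AbsoluteValue (X.residueField pt) ℝ
  isNonarchimedean : IsNonarchimedean absVal
  absVal_scalarMap : ∀ a : K, absVal (scalarMap f pt a) = v a

/-- The points of the real analytification `X_r^an`: triples of a scheme point `p`, a
non-archimedean absolute value on `K(p)` that extends the one on `K`, and an ordering of `K(p)`
that is compatible with this absolute value. -/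
structure RealAnalytification (v : AbsoluteValue K ℝ) (f : X ⟶ Spec (CommRingCat.of K)) extends
    Analytification v f where
  order : Sper (X.residueField pt)
  compatible : order.Compatible absVal

variable {v : AbsoluteValue K ℝ} {f : X ⟶ Spec (CommRingCat.of K)}

/-- `|s|_x` for a regular function `s` on an open set that contains the support of `x`. -/
def Analytification.value (x : Analytification v f) {U : X.Opens} (hx : x.pt ∈ U)
    (s : Γ(X, U)) : ℝ :=
  x.absVal (X.evaluation U x.pt hx s)

/-- `sgn_x(s) * |s|_x` for a regular function `s` on an open set that contains the support
of `x`. -/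
def RealAnalytification.signedValue (x : RealAnalytification v f) {U : X.Opens} (hx : x.pt ∈ U)
    (s : Γ(X, U)) : ℝ :=
  x.order.sgn (X.evaluation U x.pt hx s) * x.absVal (X.evaluation U x.pt hx s)

/-- The coarsest topology on `X^an` such that the support map is continuous and `x ↦ |s|_x` is
continuous on `supp⁻¹(U)` for all open `U` and all regular functions `s` on `U`. This is the
topology glued from the Berkovich spectra of the open affine subschemes of `X`. -/
instance : TopologicalSpace (Analytification v f) :=
  TopologicalSpace.generateFrom
    ({W | ∃ U : X.Opens, W = {x | x.pt ∈ U}} ∪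
     {W | ∃ (U : X.Opens) (s : Γ(X, U)) (V : Set ℝ), IsOpen V ∧
        W = {x | ∃ hx : x.pt ∈ U, x.value hx s ∈ V}})

/-- The coarsest topology on `X_r^an` such that the support map is continuous and
`x ↦ sgn_x(s) * |s|_x` is continuous on `supp⁻¹(U)` for all open `U` and all regular functions
`s` on `U`. -/
instance : TopologicalSpace (RealAnalytification v f) :=
  TopologicalSpace.generateFrom
    ({W | ∃ U : X.Opens, W = {x | x.pt ∈ U}} ∪
     {W | ∃ (U : X.Opens) (s : Γ(X, U)) (V : Set ℝ), IsOpen V ∧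
        W = {x | ∃ hx : x.pt ∈ U, x.signedValue hx s ∈ V}})

/-- The canonical map `φ : X_r^an → X^an` that forgets the ordering. -/
def forgetOrder (x : RealAnalytification v f) : Analytification v f := x.toAnalytification

end Analytification

end RealAn

end

noncomputable section

namespace RealAn

open AlgebraicGeometry CategoryTheory

/-! ### Residue fields are essentially of finite type over the base field -/

section FiniteType

variable {K : Type u} [Field K] {X : Scheme.{u}}

/-! Write `L` for the residue field at the support of `x`. On the fiber the absolute value is fixed,
so only signs vary. The fiber is thus the space of compatible orderings of `L` with the Harrison
topology (`fiberHomeomorph`).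

Baer–Krull describes these orderings. Encode an ordering as a sign character `Lˣ → {±1}`. On
elements of absolute value one, compatibility makes it factor through an ordering of `k(x)`. What
remains are the signs on a section of `Lˣ → Γ` that is multiplicative up to squares, that is, a
character of `Γ/2Γ`. Conversely, every such pair glues to a compatible ordering (`baerKrullEquiv`).

Real closedness of `K` makes `Γ/2Γ` finite (`finite_valueGroupModTwo`): `|Kˣ|` is 2-divisible, so
lifts of an `𝔽₂`-basis of `Γ/2Γ` are algebraically independent over `K`, while `L` has finite
transcendence degree. Finiteness makes the character of `Γ/2Γ` locally constant in the ordering, and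
gives `D = Hom(Γ/2Γ, {±1})` the cardinality of `Γ/2Γ`. -/

lemma essFiniteType_scalarMap (f : X ⟶ Spec (CommRingCat.of K)) [LocallyOfFiniteType f] (p : X) :
    (scalarMap f p).EssFiniteType := by
  obtain ⟨U, hU, hp, -⟩ := X.isBasis_affineOpens.exists_subset_of_mem_open
    (Set.mem_univ p) isOpen_univ
  obtain ⟨U, hU, rfl⟩ := hU
  have hU' : IsAffineOpen U := hU
  -- Factor through an affine chart: a finite type map to `Γ(X, U)`, a localization, then a
  -- quotient.
  have h₁ : scalarMap f p = (X.evaluation U p hp).hom.comp (Spec.preimage (hU'.fromSpec ≫ f)).hom := by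
    rw [scalarMap, ← CommRingCat.hom_comp]
    congr 1
    apply Spec.map_injective
    rw [Spec.map_preimage, Spec.map_comp, Spec.map_preimage, Scheme.fromSpecResidueField,
      ← hU'.fromSpecStalk_eq_fromSpecStalk hp, IsAffineOpen.fromSpecStalk, Scheme.evaluation,
      Spec.map_comp]
    simp only [Category.assoc]
  have h₂ : (Spec.preimage (hU'.fromSpec ≫ f)).hom.FiniteType := by
    rw [← HasRingHomProperty.Spec_iff (P := @LocallyOfFiniteType), Spec.map_preimage]
    infer_instance
  have h₃ : (X.presheaf.germ U p hp).hom.EssFiniteType := by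
    have := hU'.isLocalization_stalk ⟨p, hp⟩
    let := (X.presheaf.germ U p hp).hom.toAlgebra
    exact (RingHom.essFiniteType_algebraMap (R := Γ(X, U)) (S := X.presheaf.stalk p)).2
      (.of_isLocalization _ (hU'.primeIdealOf ⟨p, hp⟩).asIdeal.primeCompl)
  have h₄ : (X.residue p).hom.EssFiniteType :=
    (RingHom.FiniteType.of_surjective _ (X.residue_surjective p)).essFiniteType
  rw [h₁]
  exact h₂.essFiniteType.comp (h₃.comp h₄)

end FiniteType

/-! ### Independence modulo a 2-divisible subgroup -/

section Independence

/-- If every element of `H` is the double of an element of `H`, then a family whose image in a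
vector space over `ZMod 2` is linearly independent is `ℤ`-linearly independent modulo `H`. -/
lemma eq_zero_of_linearCombination_mem {M N ι : Type*} [AddCommGroup M] [AddCommGroup N]
    [Module (ZMod 2) N] (q : M →+ N) (hM : ∀ x : M, 2 • x = 0 → x = 0)
    (H : AddSubgroup M) (hH : ∀ x ∈ H, ∃ y ∈ H, x = 2 • y) (g : ι → M)
    (hg : LinearIndependent (ZMod 2) (q ∘ g)) (m : ι →₀ ℤ)
    (hm : Finsupp.linearCombination ℤ g m ∈ H) : m = 0 := by
  -- Reduction mod 2 makes all coefficients even. Since `M` has no 2-torsion and `H = 2H`, the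
  -- halved relation still lands in `H`, so descent applies.
  have half (m : ι →₀ ℤ) (hm : Finsupp.linearCombination ℤ g m ∈ H) :
      ∃ m' : ι →₀ ℤ, m = (2 : ℤ) • m' ∧ Finsupp.linearCombination ℤ g m' ∈ H := by
    obtain ⟨y, hy, hxy⟩ := hH _ hm
    have hN (z : N) : 2 • z = 0 := by
      rw [← Nat.cast_smul_eq_nsmul (ZMod 2)]
      simp [show (2 : ZMod 2) = 0 from rfl]
    have h0 : Finsupp.linearCombination (ZMod 2) (q ∘ g)
        (m.mapRange (Int.cast : ℤ → ZMod 2) Int.cast_zero) = 0 := by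
      rw [Finsupp.linearCombination_apply, Finsupp.sum_mapRange_index (by simp)]
      have := congrArg q hxy
      rw [map_nsmul, hN, Finsupp.linearCombination_apply, map_finsuppSum] at this
      simpa [Int.cast_smul_eq_zsmul] using this
    have h1 := linearIndependent_iff.1 hg _ h0
    have hdvd (i : ι) : (2 : ℤ) ∣ m i := by
      have := DFunLike.congr_fun h1 i
      simpa using (ZMod.intCast_zmod_eq_zero_iff_dvd _ 2).1 (by simpa using this)
    refine ⟨m.mapRange (· / 2) (by simp), ?_, ?_⟩
    · ext i
      simp [Int.mul_ediv_cancel' (hdvd i)]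
    · have hmm : m = (2 : ℤ) • m.mapRange (· / 2) (by simp) := by
        ext i
        simp [Int.mul_ediv_cancel' (hdvd i)]
      rw [hmm, map_smul] at hxy
      have : Finsupp.linearCombination ℤ g (m.mapRange (· / 2) (by simp)) - y = 0 := by
        apply hM
        rw [smul_sub, ← hxy, ofNat_zsmul, sub_self]
      rwa [sub_eq_zero.1 this]
  have pow (k : ℕ) : ∀ m : ι →₀ ℤ, Finsupp.linearCombination ℤ g m ∈ H →
      ∀ i, (2 : ℤ) ^ k ∣ m i := by
    induction k with
    | zero => simp
    | succ k ih =>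
      intro m hm i
      obtain ⟨m', rfl, hm'⟩ := half m hm
      simpa [pow_succ'] using mul_dvd_mul_left 2 (ih m' hm' i)
  ext i
  refine Int.eq_zero_of_abs_lt_dvd (pow (m i).natAbs m hm i) ?_
  rw [Int.abs_eq_natAbs]
  exact_mod_cast Nat.lt_two_pow_self

end Independence

/-! ### Finiteness of `Γ/2Γ` -/

section ValueGroup

variable {L : Type u} [Field L]

/-- A unique term of largest absolute value would determine the absolute value of the sum, which
could then not vanish. -/
lemma exists_eq_of_sum_eq_zero {w : AbsoluteValue L ℝ} (hw : IsNonarchimedean w) {ι : Type*}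
    {s : Finset ι} (hs : s.Nonempty) {l : ι → L} (hl : ∀ i ∈ s, l i ≠ 0)
    (h : ∑ i ∈ s, l i = 0) : ∃ i ∈ s, ∃ j ∈ s, i ≠ j ∧ w (l i) = w (l j) := by
  obtain ⟨k, hk, hmax⟩ := s.exists_max_image (fun i => w (l i)) hs
  by_contra! hne
  have := hw.apply_sum_eq_of_lt (fun a => (w.map_neg a).symm) hk (l := l)
    fun j hj hjk => (hmax j hj).lt_of_ne (hne j hj k hk hjk)
  rw [h, map_zero] at this
  exact hl k hk (w.eq_zero.1 this.symm)

/-- The absolute value as a homomorphism onto the value group. -/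
def unitsValue (w : AbsoluteValue L ℝ) : Lˣ →* valueGroup w :=
  (Units.map (w : L →* ℝ)).rangeRestrict

lemma unitsValue_surjective (w : AbsoluteValue L ℝ) : Function.Surjective (unitsValue w) :=
  MonoidHom.rangeRestrict_surjective _

lemma unitsValue_eq_iff {w : AbsoluteValue L ℝ} {a b : Lˣ} :
    unitsValue w a = unitsValue w b ↔ w a = w b := by
  rw [← Subtype.coe_inj, ← Units.val_inj]
  rfl

lemma unitsValue_eq_one_iff {w : AbsoluteValue L ℝ} {a : Lˣ} :
    unitsValue w a = 1 ↔ w a = 1 := by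
  rw [← map_one (unitsValue w), unitsValue_eq_iff]
  simp

lemma valueGroup_eq_of_sq_eq {w : AbsoluteValue L ℝ} {x y : valueGroup w}
    (h : x ^ 2 = y ^ 2) : x = y := by
  obtain ⟨a, rfl⟩ := unitsValue_surjective w x
  obtain ⟨b, rfl⟩ := unitsValue_surjective w y
  rw [← map_pow, ← map_pow, unitsValue_eq_iff] at h
  rw [unitsValue_eq_iff]
  simpa using h

lemma valueGroupModTwo_sq {w : AbsoluteValue L ℝ} (x : valueGroupModTwo w) : x ^ 2 = 1 := by
  obtain ⟨x, rfl⟩ := QuotientGroup.mk_surjective x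
  rw [← QuotientGroup.mk_pow, QuotientGroup.eq_one_iff]
  exact ⟨x, rfl⟩

lemma finite_valueGroupModTwo {K : Type*} [Field K] [Algebra K L] [FinTrdeg K L]
    (hK : ∀ x : K, IsSquare x ∨ IsSquare (-x)) {w : AbsoluteValue L ℝ}
    (hw : IsNonarchimedean w) : Finite (valueGroupModTwo w) := by
  let N := Additive (valueGroupModTwo w)
  let _ : Module (ZMod 2) N := AddCommGroup.zmodModule fun (x : N) => valueGroupModTwo_sq x.toMul
  let q : Additive (valueGroup w) →+ N := MonoidHom.toAdditive (QuotientGroup.mk' _)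
  obtain ⟨ι, ⟨b⟩⟩ : ∃ ι : Type, Nonempty (Module.Basis ι (ZMod 2) N) :=
    ⟨_, ⟨Module.Basis.ofVectorSpace (ZMod 2) N⟩⟩
  have hlift (x : N) : ∃ a : Lˣ, q (.ofMul (unitsValue w a)) = x := by
    obtain ⟨y, hy⟩ := QuotientGroup.mk_surjective x.toMul
    obtain ⟨a, rfl⟩ := unitsValue_surjective w y
    exact ⟨a, hy⟩
  choose a ha using fun i => hlift (b i)
  let g i : Additive (valueGroup w) := .ofMul (unitsValue w (a i))
  let H : AddSubgroup (Additive (valueGroup w)) := MonoidHom.toAdditive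
    ((unitsValue w).comp (Units.map (algebraMap K L : K →* L))) |>.range
  have hH : ∀ x ∈ H, ∃ y ∈ H, x = 2 • y := by
    rintro _ ⟨c, rfl⟩
    obtain ⟨c, rfl⟩ := Additive.ofMul.surjective c
    -- Up to sign every element of `K` is a square, and absolute values ignore signs; so `H = |Kˣ|`
    -- is 2-divisible.
    obtain ⟨d, hd⟩ : ∃ d : Kˣ, c = d ^ 2 ∨ -c = d ^ 2 := by
      rcases hK c with ⟨d, hd⟩ | ⟨d, hd⟩
      · have hd0 : d ≠ 0 := by rintro rfl; simp at hd
        exact ⟨Units.mk0 d hd0, .inl <| by ext; simp [hd, sq]⟩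
      · have hd0 : d ≠ 0 := by rintro rfl; simp at hd
        exact ⟨Units.mk0 d hd0, .inr <| by ext; simp [hd, sq]⟩
    refine ⟨_, ⟨.ofMul d, rfl⟩, ?_⟩
    change unitsValue w _ = (unitsValue w _) ^ 2
    rw [← map_pow, unitsValue_eq_iff]
    change w (algebraMap K L c) = w (algebraMap K L d ^ 2)
    have hd' : (c : K) = d ^ 2 ∨ (-c : K) = d ^ 2 :=
      hd.imp (fun h => by simp [h]) fun h => by simpa using congrArg Units.val h
    rw [← map_pow]
    rcases hd' with hd | hd
    · rw [hd]
    · rw [← hd, map_neg, w.map_neg]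
  have key := eq_zero_of_linearCombination_mem (N := N) q (fun x hx => by
      refine valueGroup_eq_of_sq_eq (x := x.toMul) (y := 1) ?_
      rw [one_pow]; exact hx)
    H hH g (by
        have : q ∘ g = b := funext ha
        rw [this]; exact b.linearIndependent)
  -- In a polynomial relation two distinct monomial terms have equal absolute value; the difference
  -- of their exponents is then a relation modulo `H`, which `key` excludes.
  have alg : AlgebraicIndependent K (fun i => (a i : L)) := by
    rw [algebraicIndependent_iff]
    intro p hp
    by_contra hp0
    rw [MvPolynomial.aeval_def, MvPolynomial.eval₂_eq] at hp
    let c (d : ι →₀ ℕ) (hd : d ∈ p.support) : Kˣ :=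
      Units.mk0 (p.coeff d) (MvPolynomial.mem_support_iff.1 hd)
    let u (d : ι →₀ ℕ) (hd : d ∈ p.support) : Lˣ :=
      Units.map (algebraMap K L : K →* L) (c d hd) * ∏ i ∈ d.support, a i ^ d i
    have hu d (hd : d ∈ p.support) :
        algebraMap K L (p.coeff d) * ∏ i ∈ d.support, (a i : L) ^ d i = u d hd := by
      simp [u, c]
    obtain ⟨d, hd, e, he, hde, hw'⟩ := exists_eq_of_sum_eq_zero hw
      (MvPolynomial.support_nonempty.2 hp0) (fun d hd => by rw [hu d hd]; exact (u d hd).ne_zero) hp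
    rw [hu d hd, hu e he, ← unitsValue_eq_iff] at hw'
    have hlin d (hd : d ∈ p.support) : Additive.ofMul (unitsValue w (u d hd)) =
        .ofMul (unitsValue w (Units.map (algebraMap K L : K →* L) (c d hd))) +
          Finsupp.linearCombination ℤ g (d.mapRange (Nat.cast : ℕ → ℤ) Nat.cast_zero) := by
      rw [Finsupp.linearCombination_apply, Finsupp.sum_mapRange_index (by simp), Finsupp.sum]
      simp [u, g]
    have hm : Finsupp.linearCombination ℤ g (d.mapRange (Nat.cast : ℕ → ℤ) Nat.cast_zero -
        e.mapRange (Nat.cast : ℕ → ℤ) Nat.cast_zero) ∈ H := by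
      have h₁ := hlin d hd
      rw [hw', hlin e he] at h₁
      have hc d hd : Additive.ofMul (unitsValue w (Units.map (algebraMap K L : K →* L) (c d hd))) ∈ H :=
        ⟨.ofMul (c d hd), rfl⟩
      have h₂ := H.sub_mem (hc e he) (hc d hd)
      rwa [sub_eq_sub_iff_add_eq_add.2 (h₁.trans (add_comm _ _)), ← map_sub] at h₂
    refine hde (Finsupp.ext fun i => ?_)
    have := DFunLike.congr_fun (key _ hm) i
    simpa [sub_eq_zero] using this
  have hfin := Cardinal.lift_lt_aleph0.2 (trdeg_lt_aleph0 K L)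
  have := alg.lift_cardinalMk_le_trdeg.trans_lt hfin
  rw [Cardinal.lift_lt_aleph0, Cardinal.mk_lt_aleph0_iff] at this
  have : Module.Finite (ZMod 2) N := Module.Finite.of_basis b
  exact Module.finite_of_finite (ZMod 2) (M := N)

end ValueGroup

/-! ### Orderings of a field as sign characters -/

section Sign

variable {F : Type u} [Field F]

lemma isOrdering_of_hasMemOrNegMem (P : RingPreordering F) [HasMemOrNegMem P] : P.IsOrdering where
  toHasMemOrNegMem := inferInstance
  toIsPrime := inferInstance

lemma Sper.mem_or_neg_mem (P : Sper F) (a : F) : a ∈ P.1 ∨ -a ∈ P.1 :=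
  P.2.toHasMemOrNegMem.mem_or_neg_mem a

lemma Sper.eq_zero_of_mem_of_neg_mem (P : Sper F) {a : F} (h : a ∈ P.1) (h' : -a ∈ P.1) :
    a = 0 := by
  by_contra ha
  refine P.1.neg_one_notMem ?_
  have := mul_mem h' (RingPreordering.inv_mem h)
  rwa [neg_mul, mul_inv_cancel₀ ha] at this

lemma Sper.pos_iff {P : Sper F} {a : F} : P.Pos a ↔ a ≠ 0 ∧ a ∈ P.1 := by
  refine ⟨fun h => ⟨?_, (P.mem_or_neg_mem a).resolve_right h⟩,
    fun h h' => h.1 (P.eq_zero_of_mem_of_neg_mem h.2 h')⟩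
  rintro rfl
  exact h (by simp)

open Classical in
/-- The sign of a nonzero element with respect to an ordering. -/
def Sper.signHom (P : Sper F) : Fˣ →* ℤˣ where
  toFun a := if (a : F) ∈ P.1 then 1 else -1
  map_one' := by simp
  map_mul' a b := by
    have key (c : Fˣ) : ¬ (c : F) ∈ P.1 ↔ -(c : F) ∈ P.1 :=
      ⟨(P.mem_or_neg_mem c).resolve_left,
        fun h h' => c.ne_zero (P.eq_zero_of_mem_of_neg_mem h' h)⟩
    by_cases ha : (a : F) ∈ P.1 <;> by_cases hb : (b : F) ∈ P.1
    · have : (a * b : F) ∈ P.1 := mul_mem ha hb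
      simp [ha, hb, this]
    · have : ((a * b : Fˣ) : F) ∉ P.1 := by
        rw [key]; simpa using mul_mem ha ((key b).1 hb)
      rw [if_neg this]
      simp [ha, hb]
    · have : ((a * b : Fˣ) : F) ∉ P.1 := by
        rw [key]; simpa using mul_mem ((key a).1 ha) hb
      rw [if_neg this]
      simp [ha, hb]
    · have : (a * b : F) ∈ P.1 := by simpa using mul_mem ((key a).1 ha) ((key b).1 hb)
      simp [ha, hb, this]

lemma Sper.signHom_eq_one_iff {P : Sper F} {a : Fˣ} : P.signHom a = 1 ↔ (a : F) ∈ P.1 := by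
  classical
  change (if (a : F) ∈ P.1 then (1 : ℤˣ) else -1) = 1 ↔ _
  split_ifs with h <;> simp [h]

lemma Sper.signHom_eq_one_iff_pos {P : Sper F} {a : Fˣ} : P.signHom a = 1 ↔ P.Pos a := by
  rw [signHom_eq_one_iff, pos_iff, and_iff_right a.ne_zero]

lemma Sper.signHom_neg_one (P : Sper F) : P.signHom (-1) = -1 :=
  (Int.units_eq_one_or _).resolve_left fun h =>
    P.1.neg_one_notMem (by simpa using signHom_eq_one_iff.1 h)

lemma Sper.signHom_neg (P : Sper F) (a : Fˣ) : P.signHom (-a) = -P.signHom a := by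
  rw [← neg_one_mul, map_mul, signHom_neg_one, neg_one_mul]

lemma Sper.signHom_injective : Function.Injective (Sper.signHom : Sper F → Fˣ →* ℤˣ) := by
  intro P Q h
  refine Subtype.ext (SetLike.ext fun x => ?_)
  by_cases hx : x = 0
  · simp [hx]
  · have := DFunLike.congr_fun h (Units.mk0 x hx)
    rw [← Units.val_mk0 hx, ← signHom_eq_one_iff, ← signHom_eq_one_iff, this]

/-- An ordering of a field from its sign character. -/
def Sper.ofSign (χ : Fˣ →* ℤˣ) (hneg : χ (-1) = -1)
    (hadd : ∀ a b : Fˣ, χ a = 1 → (b : F) = 1 + a → χ b = 1) : Sper F := by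
  have hneg' (a : Fˣ) : χ (-a) = -χ a := by rw [← neg_one_mul, map_mul, hneg, neg_one_mul]
  -- Quantifying over units equal to `x` puts `0` in the set vacuously.
  let P : RingPreordering F := RingPreordering.mk' {x | ∀ a : Fˣ, (a : F) = x → χ a = 1}
    (by
      intro x y hx hy c hc
      by_cases hx0 : x = 0
      · exact hy c (by simp [hc, hx0])
      by_cases hy0 : y = 0
      · exact hx c (by simp [hc, hy0])
      lift x to Fˣ using isUnit_iff_ne_zero.2 hx0
      lift y to Fˣ using isUnit_iff_ne_zero.2 hy0
      -- Scaling by the positive `x` reduces `x + y` to `1 + y / x`.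
      have h := hadd (y / x) (c / x) (by rw [map_div, hx x rfl, hy y rfl, div_one])
        (by simp [hc]; field_simp)
      rwa [map_div, hx x rfl, div_one] at h)
    (by
      intro x y hx hy c hc
      have hx0 : x ≠ 0 := by rintro rfl; simp at hc
      have hy0 : y ≠ 0 := by rintro rfl; simp at hc
      lift x to Fˣ using isUnit_iff_ne_zero.2 hx0
      lift y to Fˣ using isUnit_iff_ne_zero.2 hy0
      rw [← Units.val_mul, Units.val_inj] at hc
      rw [hc, map_mul, hx x rfl, hy y rfl, one_mul])
    (by
      intro x c hc
      have hx0 : x ≠ 0 := by rintro rfl; simp at hc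
      lift x to Fˣ using isUnit_iff_ne_zero.2 hx0
      rw [← Units.val_mul, Units.val_inj] at hc
      rw [hc, map_mul, Int.units_mul_self])
    (fun h => by simpa [hneg] using h (-1) (by simp))
  have : HasMemOrNegMem P := ⟨fun x => by
    by_cases hx0 : x = 0
    · exact .inl (by simp [hx0])
    lift x to Fˣ using isUnit_iff_ne_zero.2 hx0
    rcases Int.units_eq_one_or (χ x) with h | h
    · exact .inl fun a ha => by rwa [Units.val_inj.1 ha]
    · refine .inr fun a ha => ?_
      rw [← Units.val_neg, Units.val_inj] at ha
      rw [ha, hneg', h, neg_neg]⟩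
  exact ⟨P, isOrdering_of_hasMemOrNegMem P⟩

lemma Sper.signHom_ofSign (χ : Fˣ →* ℤˣ) (hneg : χ (-1) = -1)
    (hadd : ∀ a b : Fˣ, χ a = 1 → (b : F) = 1 + a → χ b = 1) :
    (Sper.ofSign χ hneg hadd).signHom = χ := by
  ext1 a
  have : (Sper.ofSign χ hneg hadd).signHom a = 1 ↔ χ a = 1 := by
    rw [signHom_eq_one_iff]
    exact ⟨fun h => h a rfl, fun h b hb => by rwa [Units.val_inj.1 hb]⟩
  rcases Int.units_eq_one_or (χ a) with h | h
  · rw [h, this, h]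
  · rw [h]
    refine (Int.units_eq_one_or _).resolve_left fun h' => ?_
    rw [this.1 h'] at h
    exact absurd h (by decide)

lemma Sper.isOpen_setOf_pos (a : F) : IsOpen {P : Sper F | P.Pos a} :=
  TopologicalSpace.isOpen_generateFrom_of_mem ⟨a, rfl⟩

lemma Sper.isOpen_setOf_signHom_eq (a : Fˣ) (e : ℤˣ) : IsOpen {P : Sper F | P.signHom a = e} := by
  rcases Int.units_eq_one_or e with rfl | rfl
  · simpa only [signHom_eq_one_iff_pos] using isOpen_setOf_pos (a : F)
  · have : {P : Sper F | P.signHom a = -1} = {P : Sper F | P.Pos (-a : Fˣ)} := by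
      ext P
      simp only [Set.mem_ofPred_eq, ← signHom_eq_one_iff_pos, signHom_neg]
      exact neg_eq_iff_eq_neg.symm
    rw [this]
    exact isOpen_setOf_pos _

end Sign

/-! ### The induced ordering of the residue field -/

section Residue

variable {L : Type u} [Field L] {w : AbsoluteValue L ℝ} (hw : IsNonarchimedean w)

lemma isUnit_valuationRing_iff {a : valuationRing w hw} : IsUnit a ↔ w a = 1 := by
  refine ⟨fun h => ?_, fun h => ?_⟩
  · obtain ⟨b, hb⟩ := h.exists_right_inv
    have h₁ : w a * w b = 1 := by
      rw [← map_mul, ← w.map_one]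
      exact congrArg (fun x : valuationRing w hw => w x) hb
    have ha : w a ≤ 1 := a.2
    have hb : w b ≤ 1 := b.2
    nlinarith [w.nonneg (a : L), w.nonneg (b : L)]
  · have ha : (a : L) ≠ 0 := by intro h0; simp [h0] at h
    refine IsUnit.of_mul_eq_one ⟨(a : L)⁻¹, ?_⟩ (Subtype.ext (mul_inv_cancel₀ ha))
    change w (a : L)⁻¹ ≤ 1
    rw [map_inv₀, h, inv_one]

/-- The residue of an element of the valuation ring. -/
abbrev residueOf : valuationRing w hw →+* residueFieldOf w hw :=
  IsLocalRing.residue (valuationRing w hw)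

lemma residueOf_ne_zero_iff {a : valuationRing w hw} : residueOf hw a ≠ 0 ↔ w a = 1 := by
  rw [IsLocalRing.residue_ne_zero_iff_isUnit, isUnit_valuationRing_iff]

lemma residueOf_eq_zero_iff {a : valuationRing w hw} : residueOf hw a = 0 ↔ w a < 1 := by
  rw [← not_iff_not, ← ne_eq, residueOf_ne_zero_iff, not_lt, le_antisymm_iff]
  exact and_iff_right a.2

/-- Reduction of elements of absolute value one. -/
def residueHom : (unitsValue w).ker →* (residueFieldOf w hw)ˣ :=
  MonoidHom.toHomUnits
    { toFun a := residueOf hw ⟨a.1, (unitsValue_eq_one_iff.1 a.2).le⟩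
      map_one' := map_one (residueOf hw)
      map_mul' a b := map_mul (residueOf hw) ⟨a.1, (unitsValue_eq_one_iff.1 a.2).le⟩
        ⟨b.1, (unitsValue_eq_one_iff.1 b.2).le⟩ }

lemma val_residueHom (a : (unitsValue w).ker) :
    (residueHom hw a : residueFieldOf w hw) =
      residueOf hw ⟨a.1, (unitsValue_eq_one_iff.1 a.2).le⟩ := rfl

lemma residueHom_surjective : Function.Surjective (residueHom hw) := by
  intro q
  obtain ⟨a, ha⟩ := IsLocalRing.residue_surjective (q : residueFieldOf w hw)
  have h : w a = 1 := (residueOf_ne_zero_iff hw).1 (ha ▸ q.ne_zero)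
  have h0 : (a : L) ≠ 0 := by intro h0; simp [h0] at h
  exact ⟨⟨Units.mk0 a h0, unitsValue_eq_one_iff.2 h⟩, Units.ext ha⟩

/-- The ordering that a compatible ordering induces on the residue field. -/
def residueOrder (P : Sper L) (hP : P.Compatible w) : Sper (residueFieldOf w hw) := by
  let R : RingPreordering (residueFieldOf w hw) := RingPreordering.mk'
    {q | ∃ a : valuationRing w hw, residueOf hw a = q ∧ (a : L) ∈ P.1}
    (by
      rintro _ _ ⟨a, rfl, ha⟩ ⟨b, rfl, hb⟩
      exact ⟨a + b, map_add _ _ _, add_mem ha hb⟩)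
    (by
      rintro _ _ ⟨a, rfl, ha⟩ ⟨b, rfl, hb⟩
      exact ⟨a * b, map_mul _ _ _, mul_mem ha hb⟩)
    (by
      intro q
      obtain ⟨a, rfl⟩ := IsLocalRing.residue_surjective q
      exact ⟨a * a, map_mul _ _ _, P.1.mul_self_mem _⟩)
    (by
      rintro ⟨a, h, ha⟩
      have h₁ : residueOf hw (1 + a) = 0 := by rw [map_add, h, map_one, add_neg_cancel]
      rw [residueOf_eq_zero_iff] at h₁
      -- Compatibility applied to `0 ≤ 1 ≤ 1 + a` contradicts `|1 + a| < 1`.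
      have h₂ := hP 1 (1 + a) (one_mem P.1) (by simpa [Sper.Nonneg] using ha)
      rw [w.map_one] at h₂
      exact h₁.not_ge h₂)
  have : HasMemOrNegMem R := ⟨fun q => by
    obtain ⟨a, rfl⟩ := IsLocalRing.residue_surjective q
    rcases P.mem_or_neg_mem a with h | h
    · exact .inl ⟨a, rfl, h⟩
    · exact .inr ⟨-a, map_neg _ _, h⟩⟩
  exact ⟨R, isOrdering_of_hasMemOrNegMem R⟩

lemma signHom_residueOrder {P : Sper L} (hP : P.Compatible w) (a : (unitsValue w).ker) :
    (residueOrder hw P hP).signHom (residueHom hw a) = P.signHom a := by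
  have key (a : (unitsValue w).ker) (ha : P.signHom a = 1) :
      (residueOrder hw P hP).signHom (residueHom hw a) = 1 :=
    Sper.signHom_eq_one_iff.2 ⟨⟨a.1, (unitsValue_eq_one_iff.1 a.2).le⟩, rfl, Sper.signHom_eq_one_iff.1 ha⟩
  rcases Int.units_eq_one_or (P.signHom a) with h | h
  · rw [h, key a h]
  · let a' : (unitsValue w).ker := ⟨-a, by
      rw [MonoidHom.mem_ker, unitsValue_eq_one_iff, Units.val_neg, w.map_neg]
      exact unitsValue_eq_one_iff.1 a.2⟩
    have h₁ := key a' (by rw [Sper.signHom_neg, h, neg_neg])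
    have h₂ : residueHom hw a' = -residueHom hw a := by
      refine Units.ext ?_
      rw [Units.val_neg, val_residueHom, val_residueHom, ← map_neg]
      rfl
    rw [h₂, Sper.signHom_neg] at h₁
    rw [h, ← h₁, neg_neg]

end Residue

/-! ### Sections of the absolute value up to squares -/

section Section

variable {L : Type u} [Field L]

/-- A section of the absolute value `Lˣ → Γ` that is multiplicative up to squares. -/
structure ValueSection (w : AbsoluteValue L ℝ) where
  toFun : valueGroup w → Lˣ
  unitsValue_toFun : ∀ γ, unitsValue w (toFun γ) = γ
  mul_eq_mul_sq : ∀ γ δ, ∃ c : Lˣ, toFun γ * toFun δ = toFun (γ * δ) * c ^ 2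

/-- The surjection from `Lˣ` modulo squares to `Γ/2Γ` is `𝔽₂`-linear, hence splits; representatives
are then adjusted by squares. -/
lemma nonempty_valueSection (w : AbsoluteValue L ℝ) : Nonempty (ValueSection w) := by
  let S := Lˣ ⧸ (powMonoidHom 2 : Lˣ →* Lˣ).range
  have hS (x : S) : x ^ 2 = 1 := by
    obtain ⟨x, rfl⟩ := QuotientGroup.mk_surjective x
    rw [← QuotientGroup.mk_pow, QuotientGroup.eq_one_iff]
    exact ⟨x, rfl⟩
  let p : S →* valueGroupModTwo w := QuotientGroup.map _ _ (unitsValue w) (by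
    rintro _ ⟨x, rfl⟩
    exact ⟨unitsValue w x, (map_pow _ _ _).symm⟩)
  have hp : Function.Surjective p := by
    intro y
    obtain ⟨y, rfl⟩ := QuotientGroup.mk_surjective y
    obtain ⟨a, rfl⟩ := unitsValue_surjective w y
    exact ⟨QuotientGroup.mk a, rfl⟩
  let _ : Module (ZMod 2) (Additive S) := AddCommGroup.zmodModule fun (x : Additive S) => hS x.toMul
  let _ : Module (ZMod 2) (Additive (valueGroupModTwo w)) :=
    AddCommGroup.zmodModule fun (x : Additive (valueGroupModTwo w)) => valueGroupModTwo_sq x.toMul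
  let p' := AddMonoidHom.toZModLinearMap 2 (M := Additive S)
    (M₁ := Additive (valueGroupModTwo w)) (MonoidHom.toAdditive p)
  obtain ⟨s, hs⟩ := p'.exists_rightInverse_of_surjective (show p'.range = ⊤ from
    LinearMap.range_eq_top.2 (by exact hp))
  let s' : valueGroupModTwo w →* S := AddMonoidHom.toMultiplicative s.toAddMonoidHom
  have hs' (x) : p (s' x) = x := LinearMap.congr_fun hs (Additive.ofMul x)
  have ht (γ : valueGroup w) : ∃ a : Lˣ, unitsValue w a = γ ∧ (a : S) = s' γ := by
    obtain ⟨a, ha⟩ := QuotientGroup.mk_surjective (s' γ)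
    have h := hs' γ
    rw [← ha] at h
    obtain ⟨δ, hδ⟩ := QuotientGroup.eq.1 (h : (unitsValue w a : valueGroupModTwo w) = γ)
    obtain ⟨b, rfl⟩ := unitsValue_surjective w δ
    -- The factor `b ^ 2` corrects the value to exactly `γ` without changing the square class.
    refine ⟨a * b ^ 2, ?_, ?_⟩
    · rw [map_mul, map_pow]
      exact eq_inv_mul_iff_mul_eq.1 hδ
    · rw [QuotientGroup.mk_mul, QuotientGroup.mk_pow, hS (b : S), ha]
      exact mul_one (s' γ)
  choose t ht₁ ht₂ using ht
  refine ⟨t, ht₁, fun γ δ => ?_⟩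
  have h : ((t (γ * δ) : Lˣ) : S) = (t γ * t δ : Lˣ) := by
    rw [QuotientGroup.mk_mul, ht₂, ht₂, ht₂, QuotientGroup.mk_mul, map_mul]
  obtain ⟨c, hc⟩ := QuotientGroup.eq.1 h
  exact ⟨c, (eq_inv_mul_iff_mul_eq.1 hc).symm⟩

namespace ValueSection

variable {w : AbsoluteValue L ℝ} (t : ValueSection w)

/-- The unit part of a nonzero element. -/
def unitPart (a : Lˣ) : (unitsValue w).ker :=
  ⟨a / t.toFun (unitsValue w a), by
    rw [MonoidHom.mem_ker, map_div, t.unitsValue_toFun, div_self']⟩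

lemma coe_unitPart (a : Lˣ) : (t.unitPart a : Lˣ) = a / t.toFun (unitsValue w a) := rfl

/-- Since `Γ` has no 2-torsion, `c` itself has absolute value one, so `ψ` is defined on it and kills
its square. -/
lemma ker_apply_eq_of_mul_sq (ψ : (unitsValue w).ker →* ℤˣ) {a b : (unitsValue w).ker} {c : Lˣ}
    (h : (a : Lˣ) = b * c ^ 2) : ψ a = ψ b := by
  have hc : c ∈ (unitsValue w).ker := by
    have := congrArg (unitsValue w) h
    rw [map_mul, a.2, b.2, one_mul, map_pow, ← one_pow 2] at this
    exact (valueGroup_eq_of_sq_eq this).symm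
  have : a = b * ⟨c, hc⟩ ^ 2 := Subtype.ext h
  rw [this, map_mul, map_pow, Int.units_sq, mul_one]

/-- The sign character with given restrictions to the section and to the elements of absolute
value one. -/
def extend (ε : valueGroupModTwo w →* ℤˣ) (ψ : (unitsValue w).ker →* ℤˣ) : Lˣ →* ℤˣ :=
  MonoidHom.mk' (fun a => ε (unitsValue w a) * ψ (t.unitPart a)) fun a b => by
    obtain ⟨c, hc⟩ := t.mul_eq_mul_sq (unitsValue w a) (unitsValue w b)
    have h : ψ (t.unitPart (a * b)) = ψ (t.unitPart a * t.unitPart b) := by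
      refine ker_apply_eq_of_mul_sq ψ (c := c) ?_
      simp only [coe_unitPart, Subgroup.coe_mul, map_mul]
      rw [div_mul_div_comm, hc, div_mul_eq_mul_div, mul_div_mul_right_eq_div]
    rw [h, map_mul, QuotientGroup.mk_mul, map_mul, map_mul]
    exact mul_mul_mul_comm _ _ _ _

lemma extend_apply (ε : valueGroupModTwo w →* ℤˣ) (ψ : (unitsValue w).ker →* ℤˣ) (a : Lˣ) :
    t.extend ε ψ a = ε (unitsValue w a) * ψ (t.unitPart a) := rfl

lemma exists_toFun_one : ∃ c : Lˣ, t.toFun 1 = c ^ 2 := by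
  obtain ⟨c, hc⟩ := t.mul_eq_mul_sq 1 1
  rw [mul_one, mul_left_cancel_iff] at hc
  exact ⟨c, hc⟩

/-- The section may send `1` to a square other than `1`, which is harmless for `ψ`. -/
lemma extend_ker (ε : valueGroupModTwo w →* ℤˣ) (ψ : (unitsValue w).ker →* ℤˣ)
    (a : (unitsValue w).ker) : t.extend ε ψ a = ψ a := by
  obtain ⟨c, hc⟩ := t.exists_toFun_one
  have ha : unitsValue w a = 1 := a.2
  rw [extend_apply, ha, QuotientGroup.mk_one, map_one, one_mul]
  refine (ker_apply_eq_of_mul_sq ψ (c := c) ?_).symm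
  rw [coe_unitPart, ha, hc, div_mul_cancel]

lemma extend_toFun (ε : valueGroupModTwo w →* ℤˣ) (ψ : (unitsValue w).ker →* ℤˣ)
    (γ : valueGroup w) : t.extend ε ψ (t.toFun γ) = ε γ := by
  have : t.unitPart (t.toFun γ) = 1 := Subtype.ext (by
    rw [coe_unitPart, t.unitsValue_toFun, div_self']; rfl)
  rw [extend_apply, this, map_one, mul_one, t.unitsValue_toFun]

/-- The restriction of a sign character to the section. -/
def restrict (χ : Lˣ →* ℤˣ) : valueGroupModTwo w →* ℤˣ :=
  QuotientGroup.lift _ (MonoidHom.mk' (fun γ => χ (t.toFun γ)) fun γ δ => by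
    obtain ⟨c, hc⟩ := t.mul_eq_mul_sq γ δ
    rw [← map_mul, hc, map_mul, map_pow, Int.units_sq, mul_one]) (by
    rintro _ ⟨γ, rfl⟩
    exact (map_pow _ _ _).trans (Int.units_sq _))

lemma restrict_mk (χ : Lˣ →* ℤˣ) (γ : valueGroup w) : t.restrict χ γ = χ (t.toFun γ) := rfl

lemma restrict_extend (ε : valueGroupModTwo w →* ℤˣ) (ψ : (unitsValue w).ker →* ℤˣ) :
    t.restrict (t.extend ε ψ) = ε := by
  refine MonoidHom.ext fun x => ?_
  obtain ⟨γ, rfl⟩ := QuotientGroup.mk_surjective x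
  rw [restrict_mk, extend_toFun]

lemma extend_restrict (χ : Lˣ →* ℤˣ) :
    t.extend (t.restrict χ) (χ.comp (unitsValue w).ker.subtype) = χ := by
  ext1 a
  rw [extend_apply, restrict_mk, MonoidHom.comp_apply, ← map_mul]
  congr 1
  exact mul_div_cancel _ _

end ValueSection

end Section

/-! ### The Baer–Krull correspondence -/

section BaerKrull

variable {L : Type u} [Field L] {w : AbsoluteValue L ℝ} (hw : IsNonarchimedean w)

/-- A character that restricts to the sign of an ordering `Q` of the residue field takes the value
`1` on `1 + a` if it does so on `a`. -/
lemma apply_one_add {χ : Lˣ →* ℤˣ} {Q : Sper (residueFieldOf w hw)}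
    (hχ : ∀ a : (unitsValue w).ker, χ a = Q.signHom (residueHom hw a)) (a b : Lˣ) (ha : χ a = 1)
    (hb : (b : L) = 1 + a) : χ b = 1 := by
  have key (a b : Lˣ) (ha : χ a = 1) (hb : (b : L) = 1 + a) (ha' : w a ≤ 1) : χ b = 1 := by
    let r : valuationRing w hw := ⟨a, ha'⟩
    have hr : residueOf hw r ∈ Q.1 := by
      rcases ha'.lt_or_eq with h | h
      · rw [(residueOf_eq_zero_iff hw).2 (show w r < 1 from h)]
        exact zero_mem _
      · have := hχ ⟨a, unitsValue_eq_one_iff.2 h⟩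
        rw [ha] at this
        exact Sper.signHom_eq_one_iff.1 this.symm
    have hr' : residueOf hw (1 + r) ≠ 0 := by
      intro h
      rw [map_add, map_one, add_comm, add_eq_zero_iff_eq_neg] at h
      exact Q.1.neg_one_notMem (h ▸ hr)
    have hwb : w b = 1 := by
      rw [hb]; exact (residueOf_ne_zero_iff hw).1 hr'
    rw [hχ ⟨b, unitsValue_eq_one_iff.2 hwb⟩, Sper.signHom_eq_one_iff, val_residueHom]
    have : (⟨b, hwb.le⟩ : valuationRing w hw) = 1 + r := Subtype.ext hb
    rw [this, map_add, map_one]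
    exact add_mem (one_mem _) hr
  rcases le_total (w a) 1 with h | h
  · exact key a b ha hb h
  -- For `|a| ≥ 1`, use `b / a = 1 + a⁻¹` instead.
  · have := key a⁻¹ (b / a) (by rw [map_inv, ha, inv_one]) (by
      simp [hb]; field_simp; ring) (by simpa using inv_le_one_of_one_le₀ h)
    rwa [map_div, ha, div_one] at this

lemma map_neg_one_of_residue {χ : Lˣ →* ℤˣ} {Q : Sper (residueFieldOf w hw)}
    (hχ : ∀ a : (unitsValue w).ker, χ a = Q.signHom (residueHom hw a)) : χ (-1) = -1 := by
  have h : (-1 : Lˣ) ∈ (unitsValue w).ker := unitsValue_eq_one_iff.2 (by simp)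
  have h' : residueHom hw ⟨-1, h⟩ = -1 := Units.ext (map_neg (residueOf hw) 1 |>.trans (by simp))
  rw [hχ ⟨-1, h⟩, h', Sper.signHom_neg_one]

/-- The ordering of a field with a given sign character that lifts an ordering of the residue
field. -/
def liftOrder (χ : Lˣ →* ℤˣ) (Q : Sper (residueFieldOf w hw))
    (hχ : ∀ a : (unitsValue w).ker, χ a = Q.signHom (residueHom hw a)) : Sper L :=
  Sper.ofSign χ (map_neg_one_of_residue hw hχ) (apply_one_add hw hχ)

lemma signHom_liftOrder {χ : Lˣ →* ℤˣ} {Q : Sper (residueFieldOf w hw)}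
    (hχ : ∀ a : (unitsValue w).ker, χ a = Q.signHom (residueHom hw a)) :
    (liftOrder hw χ Q hχ).signHom = χ :=
  Sper.signHom_ofSign ..

/-- If `0 ≤ a ≤ b` but `|b| < |a|`, then `b / a - 1` is nonnegative although its residue is `-1`. -/
lemma compatible_liftOrder {χ : Lˣ →* ℤˣ} {Q : Sper (residueFieldOf w hw)}
    (hχ : ∀ a : (unitsValue w).ker, χ a = Q.signHom (residueHom hw a)) :
    (liftOrder hw χ Q hχ).Compatible w := by
  intro a b ha hab
  by_contra! hlt
  have ha0 : a ≠ 0 := by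
    rintro rfl
    exact (w.nonneg b).not_gt (by simpa using hlt)
  have h₁ : b * a⁻¹ - 1 ∈ (liftOrder hw χ Q hχ).1 := by
    have := mul_mem hab (RingPreordering.inv_mem ha)
    rwa [sub_mul, mul_inv_cancel₀ ha0] at this
  have h₂ : w (b * a⁻¹) < 1 := by
    rw [map_mul, map_inv₀, ← div_eq_mul_inv]
    exact (div_lt_one (w.pos ha0)).2 hlt
  let r : valuationRing w hw := ⟨b * a⁻¹, h₂.le⟩
  have hr : residueOf hw (r - 1) = -1 := by
    rw [map_sub, map_one, (residueOf_eq_zero_iff hw).2 (show w r < 1 from h₂), zero_sub]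
  have hr1 : w (b * a⁻¹ - 1) = 1 :=
    (residueOf_ne_zero_iff hw (a := r - 1)).1 (by rw [hr]; simp)
  have hr0 : b * a⁻¹ - 1 ≠ 0 := by intro h; simp [h] at hr1
  have h₃ := hχ ⟨Units.mk0 _ hr0, unitsValue_eq_one_iff.2 hr1⟩
  have h₄ : residueHom hw ⟨Units.mk0 _ hr0, unitsValue_eq_one_iff.2 hr1⟩ = -1 := Units.ext hr
  rw [h₄, Sper.signHom_neg_one, ← signHom_liftOrder hw hχ, Sper.signHom_eq_one_iff.2 h₁] at h₃
  exact absurd h₃ (by decide)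

lemma extend_residue (t : ValueSection w) (ε : valueGroupModTwo w →* ℤˣ)
    (Q : Sper (residueFieldOf w hw)) (a : (unitsValue w).ker) :
    t.extend ε (Q.signHom.comp (residueHom hw)) a = Q.signHom (residueHom hw a) :=
  t.extend_ker ..

/-- The Baer–Krull bijection. -/
def baerKrullEquiv (t : ValueSection w) : {P : Sper L // P.Compatible w} ≃
    (valueGroupModTwo w →* ℤˣ) × Sper (residueFieldOf w hw) where
  toFun P := (t.restrict P.1.signHom, residueOrder hw P.1 P.2)
  invFun x := ⟨liftOrder hw _ x.2 (extend_residue hw t x.1 x.2), compatible_liftOrder hw _⟩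
  left_inv P := by
    refine Subtype.ext (Sper.signHom_injective ?_)
    refine (signHom_liftOrder hw (extend_residue hw t (t.restrict P.1.signHom)
      (residueOrder hw P.1 P.2))).trans ?_
    convert t.extend_restrict P.1.signHom using 2
    ext1 a
    exact signHom_residueOrder hw P.2 a
  right_inv x := by
    refine Prod.ext ?_ (Sper.signHom_injective ?_)
    · change t.restrict (liftOrder hw _ x.2 (extend_residue hw t x.1 x.2)).signHom = _
      rw [signHom_liftOrder, t.restrict_extend]
    · ext1 q
      obtain ⟨a, rfl⟩ := residueHom_surjective hw q
      change (residueOrder hw _ (compatible_liftOrder hw (extend_residue hw t x.1 x.2))).signHom _ = _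
      rw [signHom_residueOrder, signHom_liftOrder, extend_residue]

lemma Sper.continuous_of_pos {A : Type u} [CommRing A] {T : Type*} [TopologicalSpace T]
    {g : T → Sper A} (h : ∀ a, IsOpen {x | (g x).Pos a}) : Continuous g :=
  continuous_generateFrom_iff.2 (by rintro _ ⟨a, rfl⟩; exact h a)

lemma Sper.continuous_of_signHom {F : Type u} [Field F] {T : Type*} [TopologicalSpace T]
    {g : T → Sper F} (h : ∀ a, IsOpen {x | (g x).signHom a = 1}) : Continuous g := by
  refine continuous_of_pos fun a => ?_
  by_cases ha : a = 0
  · simp [Sper.pos_iff, ha]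
  · simpa only [signHom_eq_one_iff_pos, Units.val_mk0] using h (Units.mk0 a ha)

/-- The Baer–Krull homeomorphism. -/
def baerKrullHomeomorph [Finite (valueGroupModTwo w)]
    [TopologicalSpace (valueGroupModTwo w →* ℤˣ)] [DiscreteTopology (valueGroupModTwo w →* ℤˣ)]
    (t : ValueSection w) : {P : Sper L // P.Compatible w} ≃ₜ
      (valueGroupModTwo w →* ℤˣ) × Sper (residueFieldOf w hw) where
  toEquiv := baerKrullEquiv hw t
  continuous_toFun := by
    refine Continuous.prodMk (continuous_discrete_rng.2 fun ε => ?_)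
      (Sper.continuous_of_signHom fun q => ?_)
    -- Fixing the character of `Γ/2Γ` imposes one open sign condition per class; their intersection
    -- is open because there are finitely many.
    · have : (fun P : {P : Sper L // P.Compatible w} => t.restrict P.1.signHom) ⁻¹' {ε} =
          ⋂ x : valueGroupModTwo w, (Subtype.val ⁻¹' {P : Sper L |
            P.signHom (t.toFun (Quotient.out x)) = ε x}) := by
        ext P
        simp only [Set.mem_preimage, Set.mem_singleton_iff, Set.mem_iInter, DFunLike.ext_iff]
        refine forall_congr' fun x => ?_
        rw [Set.mem_ofPred_eq, ← t.restrict_mk]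
        congr!
        exact (QuotientGroup.out_eq' x).symm
      rw [this]
      exact isOpen_iInter_of_finite fun x =>
        (Sper.isOpen_setOf_signHom_eq _ _).preimage continuous_subtype_val
    · obtain ⟨a, rfl⟩ := residueHom_surjective hw q
      simp only [signHom_residueOrder]
      exact (Sper.isOpen_setOf_signHom_eq _ _).preimage continuous_subtype_val
  continuous_invFun := by
    refine Continuous.subtype_mk (Sper.continuous_of_signHom fun a => ?_) _
    simp only [signHom_liftOrder, ValueSection.extend_apply]
    have : {x : (valueGroupModTwo w →* ℤˣ) × Sper (residueFieldOf w hw) |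
        x.1 (unitsValue w a) * x.2.signHom (residueHom hw (t.unitPart a)) = 1} =
        ⋃ ε : valueGroupModTwo w →* ℤˣ, {ε} ×ˢ {Q : Sper (residueFieldOf w hw) |
          Q.signHom (residueHom hw (t.unitPart a)) = ε (unitsValue w a)} := by
      ext ⟨ε, Q⟩
      simp only [Set.mem_ofPred_eq, Set.mem_iUnion, Set.mem_prod, Set.mem_singleton_iff,
        exists_eq_left']
      rw [mul_eq_one_iff_inv_eq, Int.units_inv_eq_self, eq_comm]
    change IsOpen {x : (valueGroupModTwo w →* ℤˣ) × Sper (residueFieldOf w hw) |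
      x.1 (unitsValue w a) * x.2.signHom (residueHom hw (t.unitPart a)) = 1}
    rw [this]
    exact isOpen_iUnion fun ε => (isOpen_discrete {ε}).prod (Sper.isOpen_setOf_signHom_eq _ _)

end BaerKrull

/-! ### The fiber as a space of orderings -/

section Fiber

lemma Sper.sgn_eq_signHom {F : Type u} [Field F] (P : Sper F) (a : Fˣ) :
    P.sgn a = ((P.signHom a : ℤ) : ℝ) := by
  rcases Int.units_eq_one_or (P.signHom a) with h | h
  · rw [sgn, if_pos (signHom_eq_one_iff_pos.1 h), h]; simp
  · have h' : P.Pos (-(a : F)) := signHom_eq_one_iff_pos (a := -a).1 (by rw [signHom_neg, h, neg_neg])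
    have h'' : ¬ P.Pos (a : F) := by
      rw [← signHom_eq_one_iff_pos, h]; decide
    rw [sgn, if_neg h'', if_pos h', h]; simp

lemma Sper.continuous_sgn {F : Type u} [Field F] (a : Fˣ) :
    Continuous fun P : Sper F => P.sgn a := by
  simp only [sgn_eq_signHom]
  exact (continuous_of_discreteTopology (f := fun e : ℤˣ => ((e : ℤ) : ℝ))).comp
    (continuous_discrete_rng.2 fun e => isOpen_setOf_signHom_eq a e)

lemma Sper.sgn_mul_pos_iff {F : Type u} [Field F] {P : Sper F} {w : AbsoluteValue F ℝ} {a : F} :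
    0 < P.sgn a * w a ↔ P.Pos a := by
  by_cases ha : a = 0
  · simp [ha, pos_iff]
  rw [mul_pos_iff_of_pos_right (w.pos ha), sgn]
  split_ifs with h h' <;> simp [h]

variable {K : Type u} [Field K] {X : Scheme.{u}} {v : AbsoluteValue K ℝ}
  {f : X ⟶ Spec (CommRingCat.of K)} (x : Analytification v f)

lemma exists_evaluation_eq (p : X) (a : X.residueField p) :
    ∃ (U : X.Opens) (hp : p ∈ U) (s : Γ(X, U)), X.evaluation U p hp s = a := by
  obtain ⟨b, rfl⟩ := X.residue_surjective p a
  obtain ⟨U, hp, s, rfl⟩ := X.presheaf.exists_germ_eq b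
  exact ⟨U, hp, s, rfl⟩

/-- The fiber of the real analytification over `x`, as a set of orderings of the residue field. -/
def fiberEquiv : {P : Sper (X.residueField x.pt) // P.Compatible x.absVal} ≃
    ((forgetOrder : RealAnalytification v f → Analytification v f) ⁻¹' {x} :
      Set (RealAnalytification v f)) :=
  Equiv.ofBijective (fun P => ⟨⟨x, P.1, P.2⟩, rfl⟩) ⟨fun P Q h => by
    simpa [Subtype.ext_iff] using h, by
    rintro ⟨⟨y, P, hP⟩, rfl⟩
    exact ⟨⟨P, hP⟩, rfl⟩⟩

/-- The fiber of the real analytification over `x`, as a space of orderings of the residue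
field. -/
def fiberHomeomorph : {P : Sper (X.residueField x.pt) // P.Compatible x.absVal} ≃ₜ
    ((forgetOrder : RealAnalytification v f → Analytification v f) ⁻¹' {x} :
      Set (RealAnalytification v f)) where
  toEquiv := fiberEquiv x
  continuous_toFun := by
    refine Continuous.subtype_mk (continuous_generateFrom_iff.2 ?_) _
    rintro _ (⟨U, rfl⟩ | ⟨U, s, V, hV, rfl⟩)
    · change IsOpen {_P : {P : Sper (X.residueField x.pt) // P.Compatible x.absVal} | x.pt ∈ U}
      exact isOpen_const
    · by_cases hx : x.pt ∈ U
      -- The absolute value is constant on the fiber; the sign of a nonzero element is locally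
      -- constant, and a zero value gives a constant function.
      · have hc : Continuous fun P : {P : Sper (X.residueField x.pt) // P.Compatible x.absVal} =>
            P.1.sgn (X.evaluation U x.pt hx s) * x.absVal (X.evaluation U x.pt hx s) := by
          by_cases h0 : X.evaluation U x.pt hx s = 0
          · simpa [h0] using continuous_const
          · exact ((Sper.continuous_sgn (Units.mk0 _ h0)).comp continuous_subtype_val).mul_const _
        convert hV.preimage hc
        ext P
        exact ⟨fun ⟨_, h⟩ => h, fun h => ⟨hx, h⟩⟩
      · convert isOpen_empty
        ext P
        exact ⟨fun ⟨h, _⟩ => hx h, False.elim⟩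
  continuous_invFun := by
    refine continuous_induced_rng.2 (Sper.continuous_of_pos fun a => ?_)
    obtain ⟨U, hp, s, rfl⟩ := exists_evaluation_eq x.pt a
    -- A Harrison set is detected by positivity of the signed value of a regular function lifting
    -- `a`.
    have hW : IsOpen {y : RealAnalytification v f | ∃ hy : y.pt ∈ U,
        y.signedValue hy s ∈ Set.Ioi 0} :=
      TopologicalSpace.isOpen_generateFrom_of_mem (.inr ⟨U, s, _, isOpen_Ioi, rfl⟩)
    convert hW.preimage continuous_subtype_val
    ext y
    obtain ⟨P, rfl⟩ := (fiberEquiv x).surjective y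
    change Sper.Pos ((fiberEquiv x).symm (fiberEquiv x P)).1 _ ↔ _
    rw [Equiv.symm_apply_apply]
    exact ⟨fun h => ⟨hp, Sper.sgn_mul_pos_iff.2 h⟩, fun ⟨_, h⟩ => Sper.sgn_mul_pos_iff.1 h⟩

end Fiber

/-- A finite abelian group is non-canonically isomorphic to its dual; `±1` supplies enough roots of
unity for exponent dividing 2. -/
lemma card_monoidHom_units_int {A : Type*} [CommGroup A] [Finite A] (hA : ∀ x : A, x ^ 2 = 1) :
    Cardinal.mk (A →* ℤˣ) = Cardinal.mk A := by
  have h₁ : HasEnoughRootsOfUnity ℤ 2 := ⟨⟨-1, IsPrimitiveRoot.neg_one 0 (by decide)⟩, inferInstance⟩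
  have h₂ : HasEnoughRootsOfUnity ℤ (Monoid.exponent A) :=
    .of_dvd ℤ (Monoid.exponent_dvd_of_forall_pow_eq_one hA)
  obtain ⟨e⟩ := CommGroup.monoidHom_mulEquiv_of_hasEnoughRootsOfUnity A ℤ
  exact e.toEquiv.cardinal_eq

end RealAn

end

theorem mainTheorem12 {K : Type u} [Field K] [LinearOrder K] [IsStrictOrderedRing K]
    [IsRealClosed K] (v : AbsoluteValue K ℝ) (hv : IsNonarchimedean v)
    (hcompat : ∀ a b : K, 0 ≤ a → a ≤ b → v a ≤ v b)
    {X : AlgebraicGeometry.Scheme.{u}}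
    (f : X ⟶ AlgebraicGeometry.Spec (CommRingCat.of K))
    [AlgebraicGeometry.IsIntegral X] [AlgebraicGeometry.IsSeparated f]
    [AlgebraicGeometry.LocallyOfFiniteType f] [AlgebraicGeometry.QuasiCompact f]
    (x : RealAn.Analytification v f) :
    ∃ (D : Type) (_ : TopologicalSpace D), DiscreteTopology D ∧
      Cardinal.mk D = Cardinal.mk (RealAn.valueGroupModTwo x.absVal) ∧
      Nonempty
        (((RealAn.forgetOrder : RealAn.RealAnalytification v f → RealAn.Analytification v f) ⁻¹'
            {x} : Set (RealAn.RealAnalytification v f)) ≃ₜ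
          D × RealAn.Sper (RealAn.residueFieldOf x.absVal x.isNonarchimedean)) := by
  let _ : Algebra K (X.residueField x.pt) := (RealAn.scalarMap f x.pt).toAlgebra
  have : Algebra.EssFiniteType K (X.residueField x.pt) :=
    RingHom.essFiniteType_algebraMap.1 (RealAn.essFiniteType_scalarMap f x.pt)
  -- An essentially finite type field extension has finite transcendence degree.
  have : Finite (RealAn.valueGroupModTwo x.absVal) :=
    RealAn.finite_valueGroupModTwo (K := K) IsRealClosed.isSquare_or_isSquare_neg
      x.isNonarchimedean
  obtain ⟨t⟩ := RealAn.nonempty_valueSection x.absVal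
  let _ : TopologicalSpace (RealAn.valueGroupModTwo x.absVal →* ℤˣ) := ⊥
  have : DiscreteTopology (RealAn.valueGroupModTwo x.absVal →* ℤˣ) := ⟨rfl⟩
  exact ⟨_, _, this, RealAn.card_monoidHom_units_int
      (A := RealAn.valueGroupModTwo x.absVal) RealAn.valueGroupModTwo_sq,
    ⟨(RealAn.fiberHomeomorph x).symm.trans
      (RealAn.baerKrullHomeomorph x.isNonarchimedean t)⟩⟩
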